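/- Let $\mathcal X\subseteq\mathbb R^d$ be open and convex, let $F:\mathcal X\to\mathbb R$ be strictly convex and differentiable, and let $D_F(p\|q)=F(p)-F(q)-\langle\nabla F(q),p-q\rangle$ be its Bregman divergence. For $c\in\mathcal X$ and $r\in\mathbb R$, the first-type Bregman sphere with center $c$ and radius $r$ is $\{x\in\mathcal X: D_F(x\|c)=r\}$; it bounds the open ball $\{x\in\mathcal X: D_F(x\|c)<r\}$. Let $\mathcal S\subset\mathcal X$ be finite. A sphere is called empty if the open ball it bounds contains no point of $\mathcal S$, and it circumscribes a simplex if it passes through all its vertices. Let $\hat{\mathcal S}=\{(p,F(p)):p\in\mathcal S\}\subset\mathbb R^{d+1}$. The cells of $\mathrm{del}_F(\mathcal S)$ are the vertical projections to $\mathbb R^d$ of the nonempty faces of the convex hull of $\hat{\mathcal S}$ that are cut out by a non-vertical supporting hyperplane lying below the hull. A $d$-simplex of $\mathrm{del}_F(\mathcal S)$ is a nondegenerate $d$-simplex with vertices in $\mathcal S$ that is contained in a cell of $\mathrm{del}_F(\mathcal S)$ (in particular, every cell that is itself a $d$-simplex is one). A triangulation of $\mathcal S$ is a simplicial complex embedded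 in $\mathbb R^d$ with vertex set $\mathcal S$ that covers the convex hull of $\mathcal S$. $\mathcal S$ is in general position if no $d+2$ of its points lie on a common first-type Bregman sphere. **Theorem.** (1) Every first-type Bregman sphere that circumscribes a $d$-simplex of $\mathrm{del}_F(\mathcal S)$ is empty. (2) Suppose that $\mathcal S$ is in general position and affinely spans $\mathbb R^d$. Say that a triangulation $T$ of $\mathcal S$ has the empty sphere property if each of its $d$-simplices has a circumscribing first-type Bregman sphere and every such sphere is empty. (a) Every triangulation of $\mathcal S$ with the empty sphere property is equal to $\mathrm{del}_F(\mathcal S)$, i.e. has the same cells. (b) If every $d$-simplex of $\mathrm{del}_F(\mathcal S)$ has a circumscribing first-type Bregman sphere (which is automatic when $\nabla F(\mathcal X)=\mathbb R^d$), then $\mathrm{del}_F(\mathcal S)$ is a triangulation of $\mathcal S$ and has the empty sphere property. By (a), it is then the only triangulation of $\mathcal S$ with this property. -/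

import Mathlib

namespace BregmanDelaunay

noncomputable section

/-- The Bregman divergence `D_F(p ‖ q) = F p - F q - ⟪∇F q, p - q⟫` of `p` to `q`. -/
def bregmanDiv {d : ℕ} (F : EuclideanSpace ℝ (Fin d) → ℝ) (p q : EuclideanSpace ℝ (Fin d)) : ℝ :=
  F p - F q - inner ℝ (gradient F q) (p - q)

/-- The first-type Bregman sphere centred at `c` of radius `r`, in the domain `X`. -/
def bregmanSphere {d : ℕ} (X : Set (EuclideanSpace ℝ (Fin d))) (F : EuclideanSpace ℝ (Fin d) → ℝ)
    (c : EuclideanSpace ℝ (Fin d)) (r : ℝ) : Set (EuclideanSpace ℝ (Fin d)) :=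
  {x | x ∈ X ∧ bregmanDiv F x c = r}

/-- The open first-type Bregman ball bounded by the sphere centred at `c` of radius `r`. -/
def openBregmanBall {d : ℕ} (X : Set (EuclideanSpace ℝ (Fin d)))
    (F : EuclideanSpace ℝ (Fin d) → ℝ) (c : EuclideanSpace ℝ (Fin d)) (r : ℝ) :
    Set (EuclideanSpace ℝ (Fin d)) :=
  {x | x ∈ X ∧ bregmanDiv F x c < r}

/-- The first-type Bregman sphere with centre `c ∈ X` and radius `r` passes through all points
of `t`. -/
def Circumscribes {d : ℕ} (X : Set (EuclideanSpace ℝ (Fin d))) (F : EuclideanSpace ℝ (Fin d) → ℝ)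
    (c : EuclideanSpace ℝ (Fin d)) (r : ℝ) (t : Finset (EuclideanSpace ℝ (Fin d))) : Prop :=
  c ∈ X ∧ (t : Set (EuclideanSpace ℝ (Fin d))) ⊆ bregmanSphere X F c r

/-- The first-type Bregman sphere with centre `c` and radius `r` is empty: the open ball that it
bounds contains no point of `S`. -/
def IsEmptySphere {d : ℕ} (X : Set (EuclideanSpace ℝ (Fin d))) (F : EuclideanSpace ℝ (Fin d) → ℝ)
    (S : Finset (EuclideanSpace ℝ (Fin d))) (c : EuclideanSpace ℝ (Fin d)) (r : ℝ) : Prop :=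
  Disjoint (openBregmanBall X F c r) (S : Set (EuclideanSpace ℝ (Fin d)))

/-- General position: no `d + 2` points of `S` lie on a common first-type Bregman sphere. -/
def GeneralPosition {d : ℕ} (X : Set (EuclideanSpace ℝ (Fin d)))
    (F : EuclideanSpace ℝ (Fin d) → ℝ) (S : Finset (EuclideanSpace ℝ (Fin d))) : Prop :=
  ∀ t : Finset (EuclideanSpace ℝ (Fin d)), t ⊆ S → t.card = d + 2 →
    ¬ ∃ (c : EuclideanSpace ℝ (Fin d)) (r : ℝ), Circumscribes X F c r t

/-- The convex hull, in `ℝ^d × ℝ`, of the lifted points `(p, F p)`, `p ∈ S`. -/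
def liftedHull {d : ℕ} (F : EuclideanSpace ℝ (Fin d) → ℝ)
    (S : Finset (EuclideanSpace ℝ (Fin d))) : Set (EuclideanSpace ℝ (Fin d) × ℝ) :=
  convexHull ℝ ((fun p => (p, F p)) '' (S : Set (EuclideanSpace ℝ (Fin d))))

/-- `G` is a (nonempty) face of the lower convex hull of the lifted points: it is cut out of the
convex hull by a non-vertical supporting hyperplane `z = ⟪a, x⟫ + b` lying below the hull. -/
def IsLowerFace {d : ℕ} (F : EuclideanSpace ℝ (Fin d) → ℝ)
    (S : Finset (EuclideanSpace ℝ (Fin d))) (G : Set (EuclideanSpace ℝ (Fin d) × ℝ)) : Prop :=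
  G.Nonempty ∧ ∃ (a : EuclideanSpace ℝ (Fin d)) (b : ℝ),
    (∀ q ∈ liftedHull F S, inner ℝ a q.1 + b ≤ q.2) ∧
    G = {q | q ∈ liftedHull F S ∧ q.2 = inner ℝ a q.1 + b}

/-- `del_F(S)`, as its set of cells (of all dimensions): the vertical projections to `ℝ^d` of the
faces of the lower convex hull of the lifted points. -/
def del {d : ℕ} (F : EuclideanSpace ℝ (Fin d) → ℝ)
    (S : Finset (EuclideanSpace ℝ (Fin d))) : Set (Set (EuclideanSpace ℝ (Fin d))) :=
  {C | ∃ G : Set (EuclideanSpace ℝ (Fin d) × ℝ), IsLowerFace F S G ∧ C = Prod.fst '' G}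

/-- `t` is the vertex set of a (nondegenerate) `d`-simplex of `ℝ^d`. -/
def IsFullSimplex {d : ℕ} (t : Finset (EuclideanSpace ℝ (Fin d))) : Prop :=
  t.card = d + 1 ∧ AffineIndependent ℝ ((↑) : t → EuclideanSpace ℝ (Fin d))

/-- `t` is the vertex set of a `d`-simplex of `del_F(S)`: a `d`-simplex with vertices in `S` and
contained in a cell of `del_F(S)`. When the cells are simplices these are just the `d`-dimensional
cells; otherwise every `d`-simplex of every triangulation of a cell is allowed. -/
def IsDelSimplex {d : ℕ} (F : EuclideanSpace ℝ (Fin d) → ℝ)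
    (S t : Finset (EuclideanSpace ℝ (Fin d))) : Prop :=
  IsFullSimplex t ∧ t ⊆ S ∧ ∃ C ∈ del F S, convexHull ℝ (t : Set (EuclideanSpace ℝ (Fin d))) ⊆ C

/-- `T` is a triangulation of `S`: a simplicial complex embedded in `ℝ^d` whose vertex set is `S`
and which covers the convex hull of `S`. -/
def IsTriangulation {d : ℕ} (S : Finset (EuclideanSpace ℝ (Fin d)))
    (T : Geometry.SimplicialComplex ℝ (EuclideanSpace ℝ (Fin d))) : Prop :=
  T.vertices = (S : Set (EuclideanSpace ℝ (Fin d))) ∧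
    T.space = convexHull ℝ (S : Set (EuclideanSpace ℝ (Fin d)))

/-- The set of cells (of all dimensions) of a simplicial complex. -/
def cells {d : ℕ} (T : Geometry.SimplicialComplex ℝ (EuclideanSpace ℝ (Fin d))) :
    Set (Set (EuclideanSpace ℝ (Fin d))) :=
  {C | ∃ t ∈ T.faces, C = convexHull ℝ (t : Set (EuclideanSpace ℝ (Fin d)))}

/-- The empty sphere property of `T`: every `d`-simplex of `T` has a circumscribing first-type
Bregman sphere, and this sphere is empty. -/
def HasEmptySpheres {d : ℕ} (X : Set (EuclideanSpace ℝ (Fin d)))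
    (F : EuclideanSpace ℝ (Fin d) → ℝ) (S : Finset (EuclideanSpace ℝ (Fin d)))
    (T : Geometry.SimplicialComplex ℝ (EuclideanSpace ℝ (Fin d))) : Prop :=
  ∀ t ∈ T.faces, IsFullSimplex t →
    (∃ (c : EuclideanSpace ℝ (Fin d)) (r : ℝ), Circumscribes X F c r t) ∧
    ∀ (c : EuclideanSpace ℝ (Fin d)) (r : ℝ), Circumscribes X F c r t → IsEmptySphere X F S c r

end

end BregmanDelaunay

/-!
A first-type Bregman sphere is the projection of a section of the graph of `F` by a non-vertical
hyperplane: `D_F(x ‖ c) = r` says that `F x` equals the tangent at `c` raised by `r`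
(`spherePlane`). The sphere is empty exactly when this affine function lies below `F` on `S`
(`isEmptySphere_iff`). On the other side, the cells of `del F S` are the convex hulls of the nonempty
contact sets `{p ∈ S | h p = F p}` of affine functions `h` lying below `F` on `S` (`mem_del_iff`).
An affine function is determined by its values at the vertices of a `d`-simplex, so the hyperplane
of a cell containing a `d`-simplex is the hyperplane of any sphere that circumscribes the simplex;
this gives the emptiness of these spheres (`IsDelSimplex.isEmptySphere`).

For uniqueness, let `T` be a triangulation with the empty sphere property. In general position each
full-dimensional simplex of `T` is the whole contact set of its sphere (`Circumscribes.contact_eq`).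
Its faces are contact sets of slightly tilted functions (`Supports.exists_contact_eq`), and `T` is
pure, since its lower-dimensional simplices form a null set
(`IsTriangulation.exists_isFullSimplex_mem`). So every cell of `T` is in `del F S`. Conversely, the
mean of a contact set lies in some full-dimensional simplex of `T`; the two affine functions agree
there, hence the contact set consists of vertices of that simplex (`contact_subset_of_mean_mem`).

For existence, an affine function below `F` can be turned around its contact set until it meets
further lifted points, so that every contact set extends to a spanning one
(`Supports.exists_affineSpan_contact_eq_top`). By general position the spanning ones are simplices,
so the nonempty contact sets form a simplicial complex (`contactComplex`). Its vertices are all of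
`S`, by strict convexity. It covers the convex hull because over a point `x` one can
take, among the finitely many functions with spanning contact set, the one that is largest at `x`:
if `x` were outside the hull of its contact set, a separating hyperplane would provide a tilt that
is still larger at `x` (`exists_mem_convexHull_contact`).
-/

namespace BregmanDelaunay

open Topology

/-! ### Affine functions below the lift and their contact sets -/

section Contact

variable {E : Type*} [NormedAddCommGroup E] [NormedSpace ℝ E]

/-- The graph of the affine function `h` lies below the graph of `F` over `S`. -/
def Supports (F : E → ℝ) (S : Finset E) (h : E →ᵃ[ℝ] ℝ) : Prop :=
  ∀ p ∈ S, h p ≤ F p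

open Classical in
/-- The points of `S` over which the graphs of the affine function `h` and of `F` meet. -/
noncomputable def contact (F : E → ℝ) (S : Finset E) (h : E →ᵃ[ℝ] ℝ) : Finset E :=
  {p ∈ S | h p = F p}

variable {F : E → ℝ} {S : Finset E} {h g : E →ᵃ[ℝ] ℝ}

theorem mem_contact {p : E} : p ∈ contact F S h ↔ p ∈ S ∧ h p = F p := by
  classical
  simp [contact]

theorem contact_subset : contact F S h ⊆ S := fun _ hp => (mem_contact.1 hp).1

theorem affineMap_sum_smul (h : E →ᵃ[ℝ] ℝ) {s : Finset E} {w : E → ℝ} (hw : ∑ p ∈ s, w p = 1) :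
    h (∑ p ∈ s, w p • p) = ∑ p ∈ s, w p * h p := by
  obtain ⟨c, key⟩ : ∃ c, ∀ x, h x = h.linear x + c := ⟨h 0, congrFun h.decomp⟩
  rw [key, map_sum]
  simp_rw [key, mul_add, Finset.sum_add_distrib, ← Finset.sum_mul, hw, map_smul, smul_eq_mul]
  simp

theorem exists_pos_of_mem_convexHull {x : E} (hx : x ∈ convexHull ℝ (S : Set E)) (hg : 0 < g x) :
    ∃ p ∈ S, 0 < g p := by
  obtain ⟨w, hw0, hw1, rfl⟩ := Finset.mem_convexHull'.1 hx
  rw [affineMap_sum_smul g hw1] at hg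
  by_contra! hneg
  exact hg.not_ge (Finset.sum_nonpos fun p hp => mul_nonpos_of_nonneg_of_nonpos (hw0 p hp)
    (hneg p hp))

theorem Supports.le_of_mem_convexHull_contact {h' : E →ᵃ[ℝ] ℝ} (hh' : Supports F S h') {x : E}
    (hx : x ∈ convexHull ℝ (contact F S h : Set E)) : h' x ≤ h x := by
  obtain ⟨w, hw0, hw1, rfl⟩ := Finset.mem_convexHull'.1 hx
  rw [affineMap_sum_smul _ hw1, affineMap_sum_smul _ hw1]
  refine Finset.sum_le_sum fun p hp => mul_le_mul_of_nonneg_left ?_ (hw0 p hp)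
  rw [(mem_contact.1 hp).2]
  exact hh' p (contact_subset hp)

/-- Over a common point of the hulls of two contact sets, the two affine functions agree, so a
point of the first contact set that carries positive weight is in the second one as well. -/
theorem mem_contact_of_pos_weight {h' : E →ᵃ[ℝ] ℝ} (hh : Supports F S h) (hh' : Supports F S h')
    {w : E → ℝ} (hw0 : ∀ p ∈ contact F S h, 0 ≤ w p) (hw1 : ∑ p ∈ contact F S h, w p = 1)
    (hx : ∑ p ∈ contact F S h, w p • p ∈ convexHull ℝ (contact F S h' : Set E))
    {p : E} (hp : p ∈ contact F S h) (hwp : 0 < w p) : p ∈ contact F S h' := by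
  have hle := hh.le_of_mem_convexHull_contact hx
  rw [affineMap_sum_smul _ hw1, affineMap_sum_smul _ hw1] at hle
  have hterm : ∀ q ∈ contact F S h, w q * h' q ≤ w q * h q := fun q hq =>
    mul_le_mul_of_nonneg_left
      ((hh' q (contact_subset hq)).trans (mem_contact.1 hq).2.ge) (hw0 q hq)
  have heq := (Finset.sum_eq_sum_iff_of_le hterm).1
    ((Finset.sum_le_sum hterm).antisymm hle) p hp
  exact mem_contact.2 ⟨contact_subset hp,
    (mul_left_cancel₀ hwp.ne' heq).trans (mem_contact.1 hp).2⟩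

theorem convexHull_contact_inter_subset {h' : E →ᵃ[ℝ] ℝ} (hh : Supports F S h)
    (hh' : Supports F S h') :
    convexHull ℝ (contact F S h : Set E) ∩ convexHull ℝ (contact F S h' : Set E) ⊆
      convexHull ℝ ((contact F S h : Set E) ∩ contact F S h') := by
  classical
  rintro x ⟨hx, hx'⟩
  obtain ⟨w, hw0, hw1, rfl⟩ := Finset.mem_convexHull'.1 hx
  have hzero : ∀ p ∈ contact F S h, p ∉ contact F S h ∩ contact F S h' → w p = 0 :=
    fun p hp hp' => by
      by_contra hne
      exact hp' (Finset.mem_inter.2 ⟨hp, mem_contact_of_pos_weight hh hh' hw0 hw1 hx' hp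
        ((hw0 p hp).lt_of_ne' hne)⟩)
  rw [← Finset.coe_inter]
  refine Finset.mem_convexHull'.2 ⟨w, fun p hp => hw0 p (Finset.mem_inter.1 hp).1, ?_, ?_⟩
  · rw [Finset.sum_subset Finset.inter_subset_left hzero, hw1]
  · exact Finset.sum_subset Finset.inter_subset_left fun p hp hp' => by
      rw [hzero p hp hp', zero_smul]

/-- The arithmetic mean of a finite set of points. -/
noncomputable def mean (s : Finset E) : E := ∑ p ∈ s, (s.card : ℝ)⁻¹ • p

theorem sum_inv_card {ι : Type*} {s : Finset ι} (hs : s.Nonempty) :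
    ∑ _p ∈ s, (s.card : ℝ)⁻¹ = 1 := by
  rw [Finset.sum_const, nsmul_eq_mul, mul_inv_cancel₀ (by exact_mod_cast hs.card_ne_zero)]

theorem mean_mem_convexHull {s : Finset E} (hs : s.Nonempty) :
    mean s ∈ convexHull ℝ (s : Set E) :=
  Finset.mem_convexHull'.2 ⟨fun _ => (s.card : ℝ)⁻¹, fun _ _ => by positivity, sum_inv_card hs, rfl⟩

theorem contact_subset_of_mean_mem {h' : E →ᵃ[ℝ] ℝ} (hh : Supports F S h) (hh' : Supports F S h')
    (hne : (contact F S h).Nonempty)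
    (hx : mean (contact F S h) ∈ convexHull ℝ (contact F S h' : Set E)) :
    contact F S h ⊆ contact F S h' := fun _ hp =>
  mem_contact_of_pos_weight hh hh' (w := fun _ => ((contact F S h).card : ℝ)⁻¹)
    (fun _ _ => by positivity) (sum_inv_card hne) hx hp
    (inv_pos.2 (by exact_mod_cast hne.card_pos))

/-- The mean of an affinely independent set is in its relative interior. -/
theorem subset_of_mean_mem_convexHull {s u : Finset E}
    (hs : AffineIndependent ℝ ((↑) : s → E)) (hus : u ⊆ s)
    (hx : mean s ∈ convexHull ℝ (u : Set E)) : s ⊆ u := by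
  classical
  intro p hp
  by_contra hpu
  obtain ⟨w, -, hw1, hwx⟩ := Finset.mem_convexHull'.1 hx
  let v : E → ℝ := fun q => (s.card : ℝ)⁻¹ - if q ∈ u then w q else 0
  have h0 : ∑ q ∈ s, v q = 0 := by
    rw [Finset.sum_sub_distrib, sum_inv_card ⟨p, hp⟩, Finset.sum_ite_mem,
      Finset.inter_eq_right.2 hus, hw1, sub_self]
  have h1 : ∑ q ∈ s, v q • q = 0 := by
    simp only [v, sub_smul, Finset.sum_sub_distrib, ite_smul, zero_smul]
    rw [Finset.sum_ite_mem, Finset.inter_eq_right.2 hus, hwx, mean, sub_self]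
  have hv := affineIndependent_iff.1 hs s.attach (fun q => v q)
    ((Finset.sum_attach s v).trans h0) ((Finset.sum_attach s fun q => v q • q).trans h1)
    ⟨p, hp⟩ (Finset.mem_attach _ _)
  have hcard : (s.card : ℝ) ≠ 0 := by exact_mod_cast Finset.card_ne_zero_of_mem hp
  simp [v, hpu, hcard] at hv

/-- Tilting `h` slightly by a function `g` that is nonpositive on the contact set keeps it below
the lift, and cuts the contact set down to the zeros of `g`. -/
theorem Supports.exists_tilt (hh : Supports F S h) (hg : ∀ p ∈ contact F S h, g p ≤ 0) :
    ∃ ε : ℝ, 0 < ε ∧ Supports F S (h + ε • g) ∧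
      ∀ p, p ∈ contact F S (h + ε • g) ↔ p ∈ contact F S h ∧ g p = 0 := by
  have hlt : ∀ p ∈ S, p ∉ contact F S h → h p < F p := fun p hp hpc =>
    (hh p hp).lt_of_ne fun he => hpc (mem_contact.2 ⟨hp, he⟩)
  have hev : ∀ᶠ ε : ℝ in 𝓝[>] 0, ∀ p ∈ S, p ∉ contact F S h → h p + ε * g p < F p := by
    refine (Filter.eventually_all_finset S).2 fun p hp => ?_
    by_cases hpc : p ∈ contact F S h
    · simp [hpc]
    · have ht : Filter.Tendsto (fun ε : ℝ => h p + ε * g p) (𝓝[>] 0) (𝓝 (h p + 0 * g p)) :=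
        (Continuous.tendsto (by fun_prop) 0).mono_left nhdsWithin_le_nhds
      filter_upwards [ht.eventually_lt_const (by simpa using hlt p hp hpc)] with ε hε _ using hε
  obtain ⟨ε, hε, hpos⟩ := (hev.and self_mem_nhdsWithin).exists
  have hpos : 0 < ε := hpos
  refine ⟨ε, hpos, fun p hp => ?_, fun p => ⟨fun hp => ?_, fun hp => ?_⟩⟩
  · by_cases hpc : p ∈ contact F S h
    · have := mul_nonpos_of_nonneg_of_nonpos hpos.le (hg p hpc)
      simpa using (by linarith [hh p hp] : h p + ε * g p ≤ F p)
    · simpa using (hε p hp hpc).le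
  · obtain ⟨hpS, hpe⟩ := mem_contact.1 hp
    replace hpe : h p + ε * g p = F p := by simpa using hpe
    have hpc : p ∈ contact F S h := by
      by_contra hpc
      exact (hε p hpS hpc).ne hpe
    refine ⟨hpc, ?_⟩
    have : ε * g p = 0 := by linarith [(mem_contact.1 hpc).2]
    exact (mul_eq_zero.1 this).resolve_left hpos.ne'
  · refine mem_contact.2 ⟨contact_subset hp.1, ?_⟩
    simp [hp.2, (mem_contact.1 hp.1).2]

/-- Tilting `h` by a function `g` that vanishes on the contact set and is positive somewhere on
`S`, until the graph meets a further lifted point. -/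
theorem Supports.exists_enlarge (hh : Supports F S h) (hg : ∀ p ∈ contact F S h, g p = 0)
    (hpos : ∃ p ∈ S, 0 < g p) :
    ∃ ε : ℝ, 0 ≤ ε ∧ Supports F S (h + ε • g) ∧ contact F S h ⊂ contact F S (h + ε • g) := by
  classical
  obtain ⟨p₀, hp₀, hmin⟩ := Finset.exists_min_image {p ∈ S | 0 < g p} (fun p => (F p - h p) / g p)
    (by simpa [Finset.Nonempty] using hpos)
  obtain ⟨hp₀S, hp₀g⟩ := Finset.mem_filter.1 hp₀
  have hε : 0 ≤ (F p₀ - h p₀) / g p₀ := div_nonneg (sub_nonneg.2 (hh p₀ hp₀S)) hp₀g.le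
  refine ⟨(F p₀ - h p₀) / g p₀, hε, fun p hp => ?_, Finset.ssubset_iff_of_subset ?_ |>.2
    ⟨p₀, ?_, fun hc => hp₀g.ne' (hg p₀ hc)⟩⟩
  · rcases le_or_gt (g p) 0 with hgp | hgp
    · have := mul_nonpos_of_nonneg_of_nonpos hε hgp
      simpa using (by linarith [hh p hp] : h p + (F p₀ - h p₀) / g p₀ * g p ≤ F p)
    · have := (le_div_iff₀ hgp).1 (hmin p (Finset.mem_filter.2 ⟨hp, hgp⟩))
      simpa using (by linarith : h p + (F p₀ - h p₀) / g p₀ * g p ≤ F p)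
  · exact fun p hp => mem_contact.2 ⟨contact_subset hp, by
      simp [hg p hp, (mem_contact.1 hp).2]⟩
  · exact mem_contact.2 ⟨hp₀S, by simp [div_mul_cancel₀ _ hp₀g.ne']⟩

theorem affineMap_ext_of_affineSpan_eq_top {s : Set E} (hs : affineSpan ℝ s = ⊤)
    (he : Set.EqOn h g s) : h = g := by
  have hpt : ∀ x ∈ affineSpan ℝ s, h x = g x := fun x hx => by
    refine affineSpan_induction (p := fun x => h x = g x) hx he fun c u v w hu hv hw => ?_
    simp only [AffineMap.map_vadd, map_smul, AffineMap.linearMap_vsub, hu, hv, hw]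
  exact AffineMap.ext fun x => hpt x (hs ▸ AffineSubspace.mem_top ℝ E x)

theorem exists_affineMap_vanishing (hS : affineSpan ℝ (S : Set E) = ⊤) {A : Set E}
    (hA : affineSpan ℝ A ≠ ⊤) :
    ∃ g : E →ᵃ[ℝ] ℝ, (∀ p ∈ A, g p = 0) ∧ ∃ p ∈ S, g p ≠ 0 := by
  obtain ⟨g, hgA, hg⟩ : ∃ g : E →ᵃ[ℝ] ℝ, (∀ p ∈ A, g p = 0) ∧ g ≠ 0 := by
    rcases A.eq_empty_or_nonempty with rfl | ⟨p₀, hp₀⟩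
    · exact ⟨AffineMap.const ℝ E 1, by simp, fun h0 => by simpa using congrArg (· 0) h0⟩
    · have hlt : vectorSpan ℝ A < ⊤ := by
        refine lt_top_iff_ne_top.2 fun htop => hA ?_
        rw [← AffineSubspace.direction_eq_top_iff_of_nonempty ⟨p₀, mem_affineSpan ℝ hp₀⟩,
          direction_affineSpan, htop]
      obtain ⟨f, hf0, hf⟩ := Submodule.exists_le_ker_of_lt_top _ hlt
      refine ⟨f.toAffineMap - AffineMap.const ℝ E (f p₀), fun p hp => ?_, fun h0 => hf0 ?_⟩
      · have := hf (vsub_mem_vectorSpan ℝ hp hp₀)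
        simpa using this
      · have h1 := congrArg AffineMap.linear h0
        simpa using h1
  refine ⟨g, hgA, ?_⟩
  by_contra! hall
  exact hg (affineMap_ext_of_affineSpan_eq_top hS fun p hp => hall p hp)

/-- Every affine function below the lift can be turned around its contact set until the contact
set spans, and this can be done without decreasing the value at a given point of the hull. -/
theorem Supports.exists_affineSpan_contact_eq_top (hS : affineSpan ℝ (S : Set E) = ⊤)
    (hh : Supports F S h) {x : E} (hx : x ∈ convexHull ℝ (S : Set E)) :
    ∃ h' : E →ᵃ[ℝ] ℝ, Supports F S h' ∧ contact F S h ⊆ contact F S h' ∧ h x ≤ h' x ∧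
      affineSpan ℝ (contact F S h' : Set E) = ⊤ := by
  induction hn : S.card - (contact F S h).card using Nat.strong_induction_on generalizing h with
  | _ n ih =>
  by_cases htop : affineSpan ℝ (contact F S h : Set E) = ⊤
  · exact ⟨h, hh, subset_rfl, le_rfl, htop⟩
  -- A function vanishing on the contact set, with the sign for which both requirements hold.
  obtain ⟨g, hg0, hgx, hgpos⟩ : ∃ g : E →ᵃ[ℝ] ℝ, (∀ p ∈ contact F S h, g p = 0) ∧ 0 ≤ g x ∧
      ∃ p ∈ S, 0 < g p := by
    obtain ⟨g, hg0, q, hqS, hq⟩ := exists_affineMap_vanishing hS htop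
    rcases lt_trichotomy (g x) 0 with hlt | heq | hgt
    · have hpos : 0 < (-g) x := by simpa using hlt
      exact ⟨-g, fun p hp => by simp [hg0 p (by simpa using hp)], hpos.le,
        exists_pos_of_mem_convexHull hx hpos⟩
    · rcases hq.lt_or_gt with hq | hq
      · exact ⟨-g, fun p hp => by simp [hg0 p (by simpa using hp)], by simp [heq], q, hqS,
          by simpa using hq⟩
      · exact ⟨g, fun p hp => hg0 p (by simpa using hp), heq.ge, q, hqS, hq⟩
    · exact ⟨g, fun p hp => hg0 p (by simpa using hp), hgt.le,
        exists_pos_of_mem_convexHull hx hgt⟩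
  obtain ⟨ε, hε, hsup, hss⟩ := hh.exists_enlarge hg0 hgpos
  have hdec : S.card - (contact F S (h + ε • g)).card < S.card - (contact F S h).card := by
    have h1 := Finset.card_lt_card hss
    have h2 := Finset.card_le_card (contact_subset (F := F) (S := S) (h := h + ε • g))
    omega
  obtain ⟨h', hh', hsub, hle, htop'⟩ := ih _ (hn ▸ hdec) hsup rfl
  refine ⟨h', hh', hss.1.trans hsub, le_trans ?_ hle, htop'⟩
  simp [mul_nonneg hε hgx]

/-- The convex hulls of the spanning contact sets cover the convex hull of `S`: a point lies in the
hull of the contact set of the function that is largest there, among those with a spanning contact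
set. -/
theorem exists_mem_convexHull_contact (hS : affineSpan ℝ (S : Set E) = ⊤) {x : E}
    (hx : x ∈ convexHull ℝ (S : Set E)) :
    ∃ h : E →ᵃ[ℝ] ℝ, Supports F S h ∧ affineSpan ℝ (contact F S h : Set E) = ⊤ ∧
      x ∈ convexHull ℝ (contact F S h : Set E) := by
  let H : Set (E →ᵃ[ℝ] ℝ) := {h | Supports F S h ∧ affineSpan ℝ (contact F S h : Set E) = ⊤}
  have hfin : H.Finite := by
    refine Set.Finite.of_finite_image (f := contact F S)
      ((S.powerset.finite_toSet).subset ?_) ?_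
    · rintro _ ⟨h, -, rfl⟩
      exact Finset.mem_coe.2 (Finset.mem_powerset.2 contact_subset)
    · intro h hh h' _ he
      refine affineMap_ext_of_affineSpan_eq_top hh.2 fun p hp => ?_
      rw [(mem_contact.1 hp).2, (mem_contact.1 (he ▸ hp : p ∈ contact F S h')).2]
  have hne : H.Nonempty := by
    have hSne : S.Nonempty := by
      rw [← Finset.coe_nonempty, ← convexHull_nonempty_iff (𝕜 := ℝ)]
      exact ⟨x, hx⟩
    obtain ⟨p₀, -, hmin⟩ := Finset.exists_min_image S F hSne
    obtain ⟨h, h1, -, -, h2⟩ := Supports.exists_affineSpan_contact_eq_top (F := F)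
      (h := AffineMap.const ℝ E (F p₀)) hS (fun p hp => by simpa using hmin p hp) hx
    exact ⟨h, h1, h2⟩
  obtain ⟨h, hh, hmax⟩ := Set.exists_max_image H (fun h : E →ᵃ[ℝ] ℝ => h x) hfin hne
  refine ⟨h, hh.1, hh.2, ?_⟩
  by_contra hxc
  obtain ⟨f, u, hfu, hux⟩ := geometric_hahn_banach_closed_point (convex_convexHull ℝ _)
    ((contact F S h).finite_toSet.isClosed_convexHull ℝ) hxc
  obtain ⟨ε, hε, hsup, -⟩ := hh.1.exists_tilt
    (g := f.toLinearMap.toAffineMap - AffineMap.const ℝ E u)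
    fun p hp => by
      simpa using (hfu p (subset_convexHull ℝ (contact F S h : Set E) hp)).le
  obtain ⟨h', h1, -, hle, h2⟩ := hsup.exists_affineSpan_contact_eq_top hS hx
  have h3 := hle.trans (hmax h' ⟨h1, h2⟩)
  have h4 : 0 < ε * (f x - u) := mul_pos hε (sub_pos.2 hux)
  have h5 : h x + ε * (f x - u) ≤ h x := by simpa using h3
  linarith

/-- Every nonempty subset of a contact set that is the vertex set of a full-dimensional simplex is
itself a contact set. -/
theorem Supports.exists_contact_eq (hh : Supports F S h)
    (hind : AffineIndependent ℝ ((↑) : contact F S h → E))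
    (htop : affineSpan ℝ (contact F S h : Set E) = ⊤) {s : Finset E} (hs : s ⊆ contact F S h) :
    ∃ h' : E →ᵃ[ℝ] ℝ, Supports F S h' ∧ contact F S h' = s := by
  classical
  let b : AffineBasis (contact F S h) ℝ E := ⟨(↑), hind, by simpa using htop⟩
  have hb : ∀ i, b i = (i : E) := fun _ => rfl
  -- The sum of the barycentric coordinates of the vertices to be removed, with a minus sign.
  let g : E →ᵃ[ℝ] ℝ := -∑ i : contact F S h, if (i : E) ∈ s then 0 else b.coord i
  have hg : ∀ p (hp : p ∈ contact F S h), g p = if p ∈ s then 0 else -1 := fun p hp => by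
    have hsum : ∀ t : Finset (contact F S h), (∑ i ∈ t, if (i : E) ∈ s then 0 else b.coord i) p =
        ∑ i ∈ t, if (i : E) ∈ s then 0 else b.coord i p := fun t => by
      induction t using Finset.induction_on with
      | empty => simp
      | insert i t hi ih =>
        rw [Finset.sum_insert hi, Finset.sum_insert hi, AffineMap.coe_add, Pi.add_apply, ih]
        split_ifs <;> simp
    have hcoord : ∀ i, b.coord i p = if i = ⟨p, hp⟩ then 1 else 0 := fun i => by
      rw [← b.coord_apply i ⟨p, hp⟩, hb]
    simp only [g, AffineMap.coe_neg, Pi.neg_apply, hsum, hcoord]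
    rw [Finset.sum_eq_single ⟨p, hp⟩]
    · simp only [if_true]
      split_ifs <;> simp
    · intro i _ hi
      simp [hi]
    · simp
  obtain ⟨ε, -, hsup, hc⟩ := hh.exists_tilt (g := g) fun p hp => by
    rw [hg p hp]; split_ifs <;> norm_num
  refine ⟨_, hsup, Finset.ext fun p => (hc p).trans ⟨fun hp => ?_, fun hp => ⟨hs hp, ?_⟩⟩⟩
  · by_contra hps
    have := hp.2
    rw [hg p hp.1, if_neg hps] at this
    norm_num at this
  · rw [hg p (hs hp), if_pos hp]

end Contact

/-! ### The cells of the Delaunay complex as hulls of contact sets -/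

section Delaunay

variable {d : ℕ} {X : Set (EuclideanSpace ℝ (Fin d))} {F : EuclideanSpace ℝ (Fin d) → ℝ}
  {S t : Finset (EuclideanSpace ℝ (Fin d))} {c : EuclideanSpace ℝ (Fin d)} {r : ℝ}

theorem mem_liftedHull {q : EuclideanSpace ℝ (Fin d) × ℝ} :
    q ∈ liftedHull F S ↔ ∃ w : EuclideanSpace ℝ (Fin d) → ℝ, (∀ p ∈ S, 0 ≤ w p) ∧
      ∑ p ∈ S, w p = 1 ∧ ∑ p ∈ S, w p • p = q.1 ∧ ∑ p ∈ S, w p * F p = q.2 := by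
  classical
  have hinj : Set.InjOn (fun p => (p, F p)) (S : Set (EuclideanSpace ℝ (Fin d))) :=
    fun p _ p' _ he => congrArg Prod.fst he
  constructor
  · intro hq
    rw [liftedHull, ← Finset.coe_image, Finset.mem_convexHull'] at hq
    obtain ⟨w, hw0, hw1, hwq⟩ := hq
    rw [Finset.sum_image hinj] at hw1 hwq
    refine ⟨fun p => w (p, F p), fun p hp => hw0 _ (Finset.mem_image_of_mem _ hp), hw1, ?_, ?_⟩
    · rw [← hwq, Prod.fst_sum]
      rfl
    · rw [← hwq, Prod.snd_sum]
      rfl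
  · rintro ⟨w, hw0, hw1, hq1, hq2⟩
    have hmem := (convex_convexHull ℝ
      ((fun p => (p, F p)) '' (S : Set (EuclideanSpace ℝ (Fin d))))).sum_mem hw0 hw1
      (z := fun p => (p, F p)) fun p hp => subset_convexHull ℝ _ (Set.mem_image_of_mem _ hp)
    have hq : q = ∑ p ∈ S, w p • (p, F p) := by
      refine Prod.ext ?_ ?_
      · rw [Prod.fst_sum]
        exact hq1.symm
      · rw [Prod.snd_sum]
        exact hq2.symm
    rw [hq]
    exact hmem

/-- The affine function `x ↦ ⟪a, x⟫ + b`. -/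
noncomputable def innerAdd (a : EuclideanSpace ℝ (Fin d)) (b : ℝ) :
    EuclideanSpace ℝ (Fin d) →ᵃ[ℝ] ℝ :=
  (innerₗ (EuclideanSpace ℝ (Fin d)) a).toAffineMap + AffineMap.const ℝ _ b

@[simp]
theorem innerAdd_apply (a : EuclideanSpace ℝ (Fin d)) (b : ℝ) (x : EuclideanSpace ℝ (Fin d)) :
    innerAdd a b x = inner ℝ a x + b := by
  simp [innerAdd]

theorem exists_eq_innerAdd (h : EuclideanSpace ℝ (Fin d) →ᵃ[ℝ] ℝ) : ∃ a b, h = innerAdd a b := by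
  refine ⟨(InnerProductSpace.toDual ℝ _).symm (LinearMap.toContinuousLinearMap h.linear), h 0,
    AffineMap.ext fun x => ?_⟩
  rw [innerAdd_apply, InnerProductSpace.toDual_symm_apply]
  exact congrFun h.decomp x

theorem supports_iff_liftedHull {h : EuclideanSpace ℝ (Fin d) →ᵃ[ℝ] ℝ} :
    Supports F S h ↔ ∀ q ∈ liftedHull F S, h q.1 ≤ q.2 := by
  refine ⟨fun hh q hq => ?_, fun hh p hp =>
    hh (p, F p) (subset_convexHull ℝ _ (Set.mem_image_of_mem _ hp))⟩
  obtain ⟨w, hw0, hw1, hq1, hq2⟩ := mem_liftedHull.1 hq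
  rw [← hq1, ← hq2, affineMap_sum_smul h hw1]
  exact Finset.sum_le_sum fun p hp => mul_le_mul_of_nonneg_left (hh p hp) (hw0 p hp)

theorem image_fst_lowerFace {h : EuclideanSpace ℝ (Fin d) →ᵃ[ℝ] ℝ} (hh : Supports F S h) :
    Prod.fst '' {q | q ∈ liftedHull F S ∧ q.2 = h q.1} =
      convexHull ℝ (contact F S h : Set (EuclideanSpace ℝ (Fin d))) := by
  apply Set.Subset.antisymm
  · rintro _ ⟨q, ⟨hq, hqh⟩, rfl⟩
    obtain ⟨w, hw0, hw1, hq1, hq2⟩ := mem_liftedHull.1 hq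
    rw [← hq1, ← hq2, affineMap_sum_smul h hw1, eq_comm, Finset.sum_eq_sum_iff_of_le
      fun p hp => mul_le_mul_of_nonneg_left (hh p hp) (hw0 p hp)] at hqh
    have hzero : ∀ p ∈ S, p ∉ contact F S h → w p = 0 := fun p hp hpc => by
      by_contra hne
      exact hpc (mem_contact.2 ⟨hp, mul_left_cancel₀ hne (hqh p hp)⟩)
    rw [← hq1]
    refine Finset.mem_convexHull'.2 ⟨w, fun p hp => hw0 p (contact_subset hp), ?_, ?_⟩
    · rw [Finset.sum_subset contact_subset hzero, hw1]
    · exact Finset.sum_subset contact_subset fun p hp hpc => by rw [hzero p hp hpc, zero_smul]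
  · intro x hx
    refine ⟨(x, h x), ⟨?_, rfl⟩, rfl⟩
    obtain ⟨w, hw0, hw1, rfl⟩ := Finset.mem_convexHull'.1 hx
    refine convexHull_mono (Set.image_mono (Finset.coe_subset.2 contact_subset))
      (mem_liftedHull.2 ⟨w, hw0, hw1, rfl, ?_⟩)
    change _ = h _
    rw [affineMap_sum_smul h hw1]
    exact Finset.sum_congr rfl fun p hp => by rw [(mem_contact.1 hp).2]

theorem mem_del_iff {C : Set (EuclideanSpace ℝ (Fin d))} :
    C ∈ del F S ↔ ∃ h : EuclideanSpace ℝ (Fin d) →ᵃ[ℝ] ℝ, Supports F S h ∧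
      (contact F S h).Nonempty ∧
        C = convexHull ℝ (contact F S h : Set (EuclideanSpace ℝ (Fin d))) := by
  constructor
  · rintro ⟨G, ⟨hG, a, b, hab, rfl⟩, rfl⟩
    have hh : Supports F S (innerAdd a b) := supports_iff_liftedHull.2 (by simpa using hab)
    have himg := image_fst_lowerFace hh
    simp only [innerAdd_apply] at himg
    refine ⟨innerAdd a b, hh, ?_, himg⟩
    rw [← Finset.coe_nonempty, ← convexHull_nonempty_iff (𝕜 := ℝ), ← himg]
    exact hG.image _
  · rintro ⟨h, hh, hne, rfl⟩
    obtain ⟨a, b, rfl⟩ := exists_eq_innerAdd h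
    have himg := image_fst_lowerFace hh
    refine ⟨_, ⟨?_, a, b, by simpa using supports_iff_liftedHull.1 hh, rfl⟩, ?_⟩
    · rw [← Set.image_nonempty (f := Prod.fst)]
      simp only [innerAdd_apply] at himg
      rw [himg]
      exact (convexHull_nonempty_iff (𝕜 := ℝ)).2 hne
    · simpa using himg.symm

theorem contact_mem_del {h : EuclideanSpace ℝ (Fin d) →ᵃ[ℝ] ℝ} (hh : Supports F S h)
    (hne : (contact F S h).Nonempty) :
    convexHull ℝ (contact F S h : Set (EuclideanSpace ℝ (Fin d))) ∈ del F S :=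
  mem_del_iff.2 ⟨h, hh, hne, rfl⟩

/-! ### Full-dimensional simplices -/

theorem IsFullSimplex.nonempty (ht : IsFullSimplex t) : t.Nonempty :=
  Finset.card_pos.1 (by rw [ht.1]; omega)

theorem isFullSimplex_iff_affineSpan_eq_top
    (hi : AffineIndependent ℝ ((↑) : t → EuclideanSpace ℝ (Fin d))) :
    IsFullSimplex t ↔ affineSpan ℝ (t : Set (EuclideanSpace ℝ (Fin d))) = ⊤ := by
  have h1 := hi.affineSpan_eq_top_iff_card_eq_finrank_add_one
  rw [finrank_euclideanSpace_fin, Fintype.card_coe] at h1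
  rw [IsFullSimplex, and_iff_left hi, ← h1]
  simp

theorem IsFullSimplex.affineSpan_eq_top (ht : IsFullSimplex t) :
    affineSpan ℝ (t : Set (EuclideanSpace ℝ (Fin d))) = ⊤ :=
  (isFullSimplex_iff_affineSpan_eq_top ht.2).1 ht

theorem exists_isFullSimplex_subset
    (ht : affineSpan ℝ (t : Set (EuclideanSpace ℝ (Fin d))) = ⊤) :
    ∃ u ⊆ t, IsFullSimplex u := by
  obtain ⟨u, hut, hspan, hind⟩ := exists_affineIndependent ℝ _
    (t : Set (EuclideanSpace ℝ (Fin d)))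
  lift u to Finset (EuclideanSpace ℝ (Fin d)) using t.finite_toSet.subset hut
  exact ⟨u, Finset.coe_subset.1 hut, (isFullSimplex_iff_affineSpan_eq_top hind).2 (hspan.trans ht)⟩

theorem IsDelSimplex.of_subset_contact {h : EuclideanSpace ℝ (Fin d) →ᵃ[ℝ] ℝ}
    (hh : Supports F S h) (ht : IsFullSimplex t) (hth : t ⊆ contact F S h) :
    IsDelSimplex F S t :=
  ⟨ht, hth.trans contact_subset, _, contact_mem_del hh (ht.nonempty.mono hth),
    convexHull_mono (Finset.coe_subset.2 hth)⟩

/-- The convexity of `F` makes every point of `S` a vertex of each cell that contains it. -/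
theorem IsDelSimplex.exists_subset_contact (hF : ConvexOn ℝ X F)
    (hS : (S : Set (EuclideanSpace ℝ (Fin d))) ⊆ X) (ht : IsDelSimplex F S t) :
    ∃ h : EuclideanSpace ℝ (Fin d) →ᵃ[ℝ] ℝ, Supports F S h ∧ t ⊆ contact F S h := by
  obtain ⟨-, htS, C, hC, htC⟩ := ht
  obtain ⟨h, hh, -, rfl⟩ := mem_del_iff.1 hC
  refine ⟨h, hh, fun p hp => mem_contact.2 ⟨htS hp, (hh p (htS hp)).antisymm ?_⟩⟩
  obtain ⟨w, hw0, hw1, hwp⟩ := Finset.mem_convexHull'.1 (htC (subset_convexHull ℝ _ hp))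
  have hle := hF.map_sum_le hw0 hw1 fun q hq => hS (contact_subset hq)
  rw [hwp] at hle
  refine hle.trans_eq ?_
  rw [← hwp, affineMap_sum_smul h hw1]
  exact Finset.sum_congr rfl fun q hq => by rw [(mem_contact.1 hq).2, smul_eq_mul]

/-! ### Bregman spheres as affine sections of the graph -/

/-- The tangent to the graph of `F` at `c`, raised by `r`. Within the domain, this affine function
agrees with `F` exactly on the first-type Bregman sphere with centre `c` and radius `r`. -/
noncomputable def spherePlane (F : EuclideanSpace ℝ (Fin d) → ℝ)
    (c : EuclideanSpace ℝ (Fin d)) (r : ℝ) : EuclideanSpace ℝ (Fin d) →ᵃ[ℝ] ℝ :=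
  innerAdd (gradient F c) (F c + r - inner ℝ (gradient F c) c)

theorem bregmanDiv_eq (F : EuclideanSpace ℝ (Fin d) → ℝ) (p c : EuclideanSpace ℝ (Fin d))
    (r : ℝ) : bregmanDiv F p c = F p - spherePlane F c r p + r := by
  rw [bregmanDiv, spherePlane, innerAdd_apply, inner_sub_right]
  ring

theorem Circumscribes.spherePlane_apply (hc : Circumscribes X F c r t)
    {p : EuclideanSpace ℝ (Fin d)} (hp : p ∈ t) : spherePlane F c r p = F p := by
  have := (hc.2 hp).2
  rw [bregmanDiv_eq F p c r] at this
  linarith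

theorem isEmptySphere_iff (hS : (S : Set (EuclideanSpace ℝ (Fin d))) ⊆ X) :
    IsEmptySphere X F S c r ↔ Supports F S (spherePlane F c r) := by
  rw [IsEmptySphere, Set.disjoint_right]
  refine forall₂_congr fun p hp => ?_
  rw [openBregmanBall, Set.mem_ofPred_eq, bregmanDiv_eq F p c r, and_iff_right (hS hp), not_lt]
  constructor <;> intro <;> linarith

/-- An affine function with the values of `F` at the vertices of a full-dimensional simplex is the
one that belongs to any circumscribing sphere. -/
theorem Circumscribes.eq_spherePlane (hc : Circumscribes X F c r t) (ht : IsFullSimplex t)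
    {h : EuclideanSpace ℝ (Fin d) →ᵃ[ℝ] ℝ} (hth : t ⊆ contact F S h) :
    h = spherePlane F c r :=
  affineMap_ext_of_affineSpan_eq_top ht.affineSpan_eq_top fun _ hp =>
    (mem_contact.1 (hth hp)).2.trans (hc.spherePlane_apply hp).symm

theorem Circumscribes.contact_eq (hgp : GeneralPosition X F S)
    (hS : (S : Set (EuclideanSpace ℝ (Fin d))) ⊆ X) (hc : Circumscribes X F c r t)
    (ht : IsFullSimplex t) (htS : t ⊆ S) : contact F S (spherePlane F c r) = t := by
  have hsub : t ⊆ contact F S (spherePlane F c r) := fun p hp =>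
    mem_contact.2 ⟨htS hp, hc.spherePlane_apply hp⟩
  refine (Finset.eq_of_subset_of_card_le hsub ?_).symm
  by_contra! hlt
  rw [ht.1] at hlt
  obtain ⟨u, huc, hu⟩ := Finset.exists_subset_card_eq (Nat.succ_le_of_lt hlt)
  refine hgp u (huc.trans contact_subset) hu ⟨c, r, hc.1, fun p hp => ?_⟩
  obtain ⟨hpS, hpe⟩ := mem_contact.1 (huc hp)
  exact ⟨hS hpS, by rw [bregmanDiv_eq F p c r, hpe]; ring⟩

theorem IsDelSimplex.isEmptySphere (hF : ConvexOn ℝ X F)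
    (hS : (S : Set (EuclideanSpace ℝ (Fin d))) ⊆ X) (ht : IsDelSimplex F S t)
    (hc : Circumscribes X F c r t) : IsEmptySphere X F S c r := by
  obtain ⟨h, hh, hth⟩ := ht.exists_subset_contact hF hS
  rw [isEmptySphere_iff hS, ← hc.eq_spherePlane ht.1 hth]
  exact hh

/-- The gradient inequality for a strictly convex function. -/
theorem spherePlane_zero_lt (hXo : IsOpen X) (hF : StrictConvexOn ℝ X F)
    (hFd : DifferentiableOn ℝ F X) {p q : EuclideanSpace ℝ (Fin d)} (hp : p ∈ X) (hq : q ∈ X)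
    (hne : q ≠ p) : spherePlane F p 0 q < F q := by
  have hgrad := (hFd.differentiableAt (hXo.mem_nhds hp)).hasGradientAt.hasFDerivAt
  have weak : ∀ y ∈ X, inner ℝ (gradient F p) (y - p) ≤ F y - F p := fun y hy => by
    have hline : HasDerivAt (fun s : ℝ => F (p + s • (y - p)))
        (inner ℝ (gradient F p) (y - p)) 0 := by
      have hl : HasDerivAt (fun s : ℝ => p + s • (y - p)) (y - p) 0 := by
        simpa using ((hasDerivAt_id (0 : ℝ)).smul_const (y - p)).const_add p
      have hgrad' : HasFDerivAt F (InnerProductSpace.toDual ℝ _ (gradient F p))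
          (p + (0 : ℝ) • (y - p)) := by simpa using hgrad
      exact hgrad'.comp_hasDerivAt 0 hl
    refine le_of_tendsto hline.tendsto_slope_zero_right ?_
    filter_upwards [Ioo_mem_nhdsGT (zero_lt_one' ℝ)] with s hs
    have hconv := hF.convexOn.2 hp hy (sub_nonneg.2 hs.2.le) hs.1.le (sub_add_cancel 1 s)
    have hpt : (1 - s) • p + s • y = p + s • (y - p) := by module
    rw [hpt] at hconv
    simp only [zero_add, zero_smul, add_zero, smul_eq_mul] at hconv ⊢
    rw [inv_mul_le_iff₀ hs.1]
    linarith
  -- Strictness comes from comparing the weak inequality at the midpoint with strict convexity.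
  have hhalf : (0 : ℝ) < 1 / 2 := by norm_num
  have hmid := hF.2 hp hq hne.symm hhalf hhalf (by norm_num)
  have hmem := hF.1 hp hq hhalf.le hhalf.le (by norm_num)
  have hw := weak _ hmem
  have hpt : (1 / 2 : ℝ) • p + (1 / 2 : ℝ) • q - p = (1 / 2 : ℝ) • (q - p) := by module
  rw [hpt, inner_smul_right] at hw
  simp only [smul_eq_mul] at hmid
  have hd : bregmanDiv F q p = F q - F p - inner ℝ (gradient F p) (q - p) := rfl
  rw [bregmanDiv_eq F q p 0] at hd
  linarith

theorem supports_spherePlane_zero (hXo : IsOpen X) (hF : StrictConvexOn ℝ X F)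
    (hFd : DifferentiableOn ℝ F X) (hS : (S : Set (EuclideanSpace ℝ (Fin d))) ⊆ X)
    {p : EuclideanSpace ℝ (Fin d)} (hp : p ∈ S) :
    Supports F S (spherePlane F p 0) ∧ contact F S (spherePlane F p 0) = {p} := by
  have hpp : spherePlane F p 0 p = F p := by simp [spherePlane]
  have hlt : ∀ q ∈ S, q ≠ p → spherePlane F p 0 q < F q := fun q hq hne =>
    spherePlane_zero_lt hXo hF hFd (hS hp) (hS hq) hne
  refine ⟨fun q hq => ?_, Finset.ext fun q => ?_⟩
  · rcases eq_or_ne q p with rfl | hne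
    · exact hpp.le
    · exact (hlt q hq hne).le
  · rw [Finset.mem_singleton]
    refine ⟨fun hqc => ?_, ?_⟩
    · by_contra hne
      exact (hlt q (contact_subset hqc) hne).ne (mem_contact.1 hqc).2
    · rintro rfl
      exact mem_contact.2 ⟨hp, hpp⟩

/-! ### Triangulations of a full-dimensional point set -/

variable {T : Geometry.SimplicialComplex ℝ (EuclideanSpace ℝ (Fin d))}

theorem IsTriangulation.subset_of_mem_faces (hT : IsTriangulation S T) (ht : t ∈ T.faces) :
    t ⊆ S := fun p hp => by
  have : p ∈ T.vertices := T.down_closed ht (Finset.singleton_subset_iff.2 hp)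
    (Finset.singleton_nonempty p)
  rwa [hT.1] at this

theorem IsTriangulation.finite_faces (hT : IsTriangulation S T) : T.faces.Finite :=
  S.powerset.finite_toSet.subset fun _ ht =>
    Finset.mem_coe.2 (Finset.mem_powerset.2 (hT.subset_of_mem_faces ht))

/-- The full-dimensional simplices alone already cover: the others form a null set, while the
convex hull of `S` is the closure of its interior. -/
theorem IsTriangulation.exists_isFullSimplex_mem (hT : IsTriangulation S T)
    (hS : affineSpan ℝ (S : Set (EuclideanSpace ℝ (Fin d))) = ⊤)
    {x : EuclideanSpace ℝ (Fin d)}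
    (hx : x ∈ convexHull ℝ (S : Set (EuclideanSpace ℝ (Fin d)))) :
    ∃ t ∈ T.faces, IsFullSimplex t ∧
      x ∈ convexHull ℝ (t : Set (EuclideanSpace ℝ (Fin d))) := by
  let K := convexHull ℝ (S : Set (EuclideanSpace ℝ (Fin d)))
  let A := {t | t ∈ T.faces ∧ IsFullSimplex t}
  let B := {t | t ∈ T.faces ∧ ¬ IsFullSimplex t}
  let U := ⋃ t ∈ A, convexHull ℝ (t : Set (EuclideanSpace ℝ (Fin d)))
  let N := ⋃ t ∈ B, convexHull ℝ (t : Set (EuclideanSpace ℝ (Fin d)))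
  have hclosed : IsClosed U := (hT.finite_faces.subset fun _ h => h.1).isClosed_biUnion
    fun t _ => t.finite_toSet.isClosed_convexHull ℝ
  have hnull : MeasureTheory.volume N = 0 := by
    refine (MeasureTheory.measure_biUnion_null_iff
      (hT.finite_faces.subset fun _ h => h.1).countable).2 fun t ht => ?_
    refine MeasureTheory.measure_mono_null (convexHull_subset_affineSpan _)
      (MeasureTheory.Measure.addHaar_affineSubspace _ _ fun htop => ht.2 ?_)
    exact (isFullSimplex_iff_affineSpan_eq_top (T.indep ht.1)).2 htop
  have hsub : interior K ⊆ U := by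
    have hopen : IsOpen (interior K \ U) := isOpen_interior.sdiff hclosed
    have hN : interior K \ U ⊆ N := fun y hy => by
      have hy' : y ∈ T.space := hT.2 ▸ interior_subset hy.1
      obtain ⟨t, ht, hyt⟩ := Geometry.SimplicialComplex.mem_space_iff.1 hy'
      refine Set.mem_biUnion (⟨ht, fun hfull => hy.2 ?_⟩ : t ∈ B) hyt
      exact Set.mem_biUnion (⟨ht, hfull⟩ : t ∈ A) hyt
    rw [← Set.sdiff_eq_empty]
    exact hopen.measure_eq_zero_iff MeasureTheory.volume |>.1
      (MeasureTheory.measure_mono_null hN hnull)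
  have hxU : x ∈ U := by
    refine closure_minimal hsub hclosed ?_
    rw [(convex_convexHull ℝ _).closure_interior_eq_closure_of_nonempty_interior
      (interior_convexHull_nonempty_iff_affineSpan_eq_top.2 hS)]
    exact subset_closure hx
  obtain ⟨t, ht, hxt⟩ := Set.mem_iUnion₂.1 hxU
  exact ⟨t, ht.1, ht.2, hxt⟩

/-- A triangulation of a full-dimensional point set is pure. -/
theorem IsTriangulation.exists_isFullSimplex_superset (hT : IsTriangulation S T)
    (hS : affineSpan ℝ (S : Set (EuclideanSpace ℝ (Fin d))) = ⊤) (ht : t ∈ T.faces) :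
    ∃ u ∈ T.faces, IsFullSimplex u ∧ t ⊆ u := by
  classical
  have hmean := mean_mem_convexHull (T.nonempty_of_mem_faces ht)
  obtain ⟨u, hu, hfull, hmem⟩ := hT.exists_isFullSimplex_mem hS
    (convexHull_mono (Finset.coe_subset.2 (hT.subset_of_mem_faces ht)) hmean)
  refine ⟨u, hu, hfull, ?_⟩
  have h1 := T.inter_subset_convexHull ht hu ⟨hmean, hmem⟩
  rw [← Finset.coe_inter] at h1
  exact (subset_of_mean_mem_convexHull (T.indep ht) Finset.inter_subset_left h1).trans
    Finset.inter_subset_right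

theorem IsTriangulation.cells_eq_del (hX : (S : Set (EuclideanSpace ℝ (Fin d))) ⊆ X)
    (hS : affineSpan ℝ (S : Set (EuclideanSpace ℝ (Fin d))) = ⊤)
    (hgp : GeneralPosition X F S) (hT : IsTriangulation S T) (hE : HasEmptySpheres X F S T) :
    cells T = del F S := by
  have hfull : ∀ u ∈ T.faces, IsFullSimplex u → ∃ h : EuclideanSpace ℝ (Fin d) →ᵃ[ℝ] ℝ,
      Supports F S h ∧ contact F S h = u := fun u hu huf => by
    obtain ⟨⟨c, r, hc⟩, hempty⟩ := hE u hu huf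
    exact ⟨spherePlane F c r, (isEmptySphere_iff hX).1 (hempty c r hc),
      hc.contact_eq hgp hX huf (hT.subset_of_mem_faces hu)⟩
  apply Set.Subset.antisymm
  · rintro _ ⟨t, ht, rfl⟩
    obtain ⟨u, hu, huf, htu⟩ := hT.exists_isFullSimplex_superset hS ht
    obtain ⟨h, hh, rfl⟩ := hfull u hu huf
    obtain ⟨h', hh', rfl⟩ := hh.exists_contact_eq huf.2 huf.affineSpan_eq_top htu
    exact contact_mem_del hh' (T.nonempty_of_mem_faces ht)
  · intro C hC
    obtain ⟨h, hh, hne, rfl⟩ := mem_del_iff.1 hC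
    have hmean := mean_mem_convexHull hne
    obtain ⟨u, hu, huf, hmem⟩ := hT.exists_isFullSimplex_mem hS
      (convexHull_mono (Finset.coe_subset.2 contact_subset) hmean)
    obtain ⟨h', hh', rfl⟩ := hfull u hu huf
    exact ⟨_, T.down_closed hu (contact_subset_of_mean_mem hh hh' hne hmem) hne, rfl⟩

/-! ### The Delaunay complex as a triangulation -/

/-- If the simplices of `del F S` have circumscribing spheres, then general position forces every
spanning contact set to be the vertex set of a simplex. -/
theorem isFullSimplex_contact (hX : (S : Set (EuclideanSpace ℝ (Fin d))) ⊆ X)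
    (hgp : GeneralPosition X F S)
    (hcirc : ∀ t, IsDelSimplex F S t → ∃ c r, Circumscribes X F c r t)
    {h : EuclideanSpace ℝ (Fin d) →ᵃ[ℝ] ℝ} (hh : Supports F S h)
    (htop : affineSpan ℝ (contact F S h : Set (EuclideanSpace ℝ (Fin d))) = ⊤) :
    IsFullSimplex (contact F S h) := by
  obtain ⟨t, hth, ht⟩ := exists_isFullSimplex_subset htop
  obtain ⟨c, r, hc⟩ := hcirc t (.of_subset_contact hh ht hth)
  rwa [hc.eq_spherePlane ht hth, hc.contact_eq hgp hX ht (hth.trans contact_subset)]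

/-- If every contact set extends to one that is the vertex set of a full-dimensional simplex, then
the nonempty contact sets are the faces of a simplicial complex. -/
def contactComplex (F : EuclideanSpace ℝ (Fin d) → ℝ) (S : Finset (EuclideanSpace ℝ (Fin d)))
    (hext : ∀ h : EuclideanSpace ℝ (Fin d) →ᵃ[ℝ] ℝ, Supports F S h → (contact F S h).Nonempty →
      ∃ h' : EuclideanSpace ℝ (Fin d) →ᵃ[ℝ] ℝ, Supports F S h' ∧
        contact F S h ⊆ contact F S h' ∧ IsFullSimplex (contact F S h')) :
    Geometry.SimplicialComplex ℝ (EuclideanSpace ℝ (Fin d)) where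
  faces := {t | t.Nonempty ∧
    ∃ h : EuclideanSpace ℝ (Fin d) →ᵃ[ℝ] ℝ, Supports F S h ∧ contact F S h = t}
  isRelLowerSet_faces := by
    rintro t ⟨hne, h, hh, rfl⟩
    refine ⟨hne, fun s hs hsne => ⟨hsne, ?_⟩⟩
    obtain ⟨h', hh', hsub, hfull⟩ := hext h hh hne
    exact hh'.exists_contact_eq hfull.2 hfull.affineSpan_eq_top (hs.trans hsub)
  indep := by
    rintro s ⟨hne, h, hh, rfl⟩
    obtain ⟨h', -, hsub, hfull⟩ := hext h hh hne
    exact hfull.2.mono (Finset.coe_subset.2 hsub)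
  inter_subset_convexHull := by
    rintro s t ⟨-, h, hh, rfl⟩ ⟨-, h', hh', rfl⟩
    exact convexHull_contact_inter_subset hh hh'

theorem exists_isTriangulation_cells_eq_del (hXo : IsOpen X) (hF : StrictConvexOn ℝ X F)
    (hFd : DifferentiableOn ℝ F X) (hX : (S : Set (EuclideanSpace ℝ (Fin d))) ⊆ X)
    (hS : affineSpan ℝ (S : Set (EuclideanSpace ℝ (Fin d))) = ⊤)
    (hgp : GeneralPosition X F S)
    (hcirc : ∀ t, IsDelSimplex F S t → ∃ c r, Circumscribes X F c r t) :
    ∃ T : Geometry.SimplicialComplex ℝ (EuclideanSpace ℝ (Fin d)),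
      IsTriangulation S T ∧ cells T = del F S ∧ HasEmptySpheres X F S T := by
  have hext : ∀ h : EuclideanSpace ℝ (Fin d) →ᵃ[ℝ] ℝ, Supports F S h →
      (contact F S h).Nonempty → ∃ h' : EuclideanSpace ℝ (Fin d) →ᵃ[ℝ] ℝ, Supports F S h' ∧
        contact F S h ⊆ contact F S h' ∧ IsFullSimplex (contact F S h') := by
    rintro h hh ⟨p, hp⟩
    obtain ⟨h', hh', hsub, -, htop⟩ := hh.exists_affineSpan_contact_eq_top hS
      (subset_convexHull ℝ _ (contact_subset hp))
    exact ⟨h', hh', hsub, isFullSimplex_contact hX hgp hcirc hh' htop⟩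
  refine ⟨contactComplex F S hext, ⟨?_, ?_⟩, ?_, ?_⟩
  · ext p
    constructor
    · rintro ⟨-, h, -, he⟩
      exact contact_subset (he ▸ Finset.mem_singleton_self p : p ∈ contact F S h)
    · exact fun hp => ⟨Finset.singleton_nonempty p, _,
        supports_spherePlane_zero hXo hF hFd hX hp⟩
  · ext x
    rw [Geometry.SimplicialComplex.mem_space_iff]
    constructor
    · rintro ⟨_, ⟨-, h, -, rfl⟩, hx⟩
      exact convexHull_mono (Finset.coe_subset.2 contact_subset) hx
    · intro hx
      obtain ⟨h, hh, -, hxh⟩ := exists_mem_convexHull_contact (F := F) hS hx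
      exact ⟨_, ⟨Finset.coe_nonempty.1 (convexHull_nonempty_iff.1 ⟨x, hxh⟩), h, hh, rfl⟩, hxh⟩
  · ext C
    rw [mem_del_iff]
    constructor
    · rintro ⟨_, ⟨hne, h, hh, rfl⟩, rfl⟩
      exact ⟨h, hh, hne, rfl⟩
    · rintro ⟨h, hh, hne, rfl⟩
      exact ⟨_, ⟨hne, h, hh, rfl⟩, rfl⟩
  · rintro _ ⟨-, h, hh, rfl⟩ hfull
    have hdel : IsDelSimplex F S (contact F S h) := .of_subset_contact hh hfull subset_rfl
    exact ⟨hcirc _ hdel, fun c r hc => hdel.isEmptySphere hF.convexOn hX hc⟩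

end Delaunay

end BregmanDelaunay

theorem mainTheorem9 (d : ℕ) (X : Set (EuclideanSpace ℝ (Fin d))) (hXo : IsOpen X)
    (hXc : Convex ℝ X) (F : EuclideanSpace ℝ (Fin d) → ℝ) (hFc : StrictConvexOn ℝ X F)
    (hFd : DifferentiableOn ℝ F X) (S : Finset (EuclideanSpace ℝ (Fin d)))
    (hS : (S : Set (EuclideanSpace ℝ (Fin d))) ⊆ X) :
    -- every first-type Bregman sphere circumscribing a simplex of `del_F(S)` is empty
    (∀ t : Finset (EuclideanSpace ℝ (Fin d)), BregmanDelaunay.IsDelSimplex F S t →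
      ∀ (c : EuclideanSpace ℝ (Fin d)) (r : ℝ), BregmanDelaunay.Circumscribes X F c r t →
        BregmanDelaunay.IsEmptySphere X F S c r) ∧
    (affineSpan ℝ (S : Set (EuclideanSpace ℝ (Fin d))) = ⊤ →
      BregmanDelaunay.GeneralPosition X F S →
      -- uniqueness: a triangulation of `S` with the empty sphere property is `del_F(S)`
      (∀ T : Geometry.SimplicialComplex ℝ (EuclideanSpace ℝ (Fin d)),
        BregmanDelaunay.IsTriangulation S T → BregmanDelaunay.HasEmptySpheres X F S T →
        BregmanDelaunay.cells T = BregmanDelaunay.del F S) ∧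
      -- `del_F(S)` is a triangulation of `S` with the empty sphere property, provided that its
      -- simplices have circumscribing first-type Bregman spheres
      ((∀ t : Finset (EuclideanSpace ℝ (Fin d)), BregmanDelaunay.IsDelSimplex F S t →
          ∃ (c : EuclideanSpace ℝ (Fin d)) (r : ℝ), BregmanDelaunay.Circumscribes X F c r t) →
        ∃ T : Geometry.SimplicialComplex ℝ (EuclideanSpace ℝ (Fin d)),
          BregmanDelaunay.IsTriangulation S T ∧
          BregmanDelaunay.cells T = BregmanDelaunay.del F S ∧
          BregmanDelaunay.HasEmptySpheres X F S T)) := by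
  refine ⟨fun t ht c r hc => ht.isEmptySphere hFc.convexOn hS hc, fun hspan hgp => ⟨?_, ?_⟩⟩
  · exact fun T hT hE => hT.cells_eq_del hS hspan hgp hE
  · exact BregmanDelaunay.exists_isTriangulation_cells_eq_del hXo hFc hFd hS hspan hgp
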